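/- Let $X$ be an arbitrary topological space. For an ordinal $\alpha$, a net $(B_\xi:\xi<\alpha)$ of subsets of $X$ is said to occupy a net $(A_\xi:\xi<\alpha)$ of subsets of $X$ if $A_\xi\subseteq B_\xi$ for every $\xi<\alpha$ and $A_\beta\subseteq\bigcup_{\xi<\beta}B_\xi$ for every (nonzero) limit ordinal $\beta<\alpha$. The space $X$ is strongly Baire if for every ordinal $\alpha$ and all increasing (i.e. $A_\xi\subseteq A_\eta$ and $B_\xi\subseteq B_\eta$ for $\xi\le\eta<\alpha$) nets $(A_\xi:\xi<\alpha)$ and $(B_\xi:\xi<\alpha)$ of closed subsets of $X$ such that $(B_\xi:\xi<\alpha)$ occupies $(A_\xi:\xi<\alpha)$, $$\operatorname{int}\Big(\bigcup_{\xi<\alpha}A_\xi\Big)\subseteq\overline{\bigcup_{\xi<\alpha}\operatorname{int}(B_\xi)}.$$ The space $X$ has the countable chain condition if every system of pairwise disjoint open subsets of $X$ is at most countable. A cardinal $\aleph$ is a caliber of $X$ if for every family $(U_i)_{i\in I}$ of nonempty open subsets of $X$ with $|I|=\aleph$ there is $J\subseteq I$ with $|J|=\aleph$ and $\bigcap_{i\in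 J}U_i\neq\emptyset$. Let $C_p(X)$ be the space of all continuous functions $X\to\mathbb R$ with the topology of pointwise convergence. **Theorem 4.1.** (i) If $X$ is strongly Baire and has the countable chain condition, then every compact subset $Y\subseteq C_p(X)$ is metrizable. (ii) In particular, if $X$ is a Baire space and every regular uncountable cardinal is a caliber of $X$, then $X$ is strongly Baire and has the countable chain condition, and hence every compact subset $Y\subseteq C_p(X)$ is metrizable. -/

import Mathlib

open Set
open scoped Cardinal

universe u

/-- The net `(B ξ : ξ < α)` of sets occupies the net `(A ξ : ξ < α)`.
Only the values at `ξ < α` matter; `0` is not a limit ordinal (`Order.IsSuccLimit`). -/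
def Occupies {X : Type u} (α : Ordinal.{u}) (B A : Ordinal.{u} → Set X) : Prop :=
  (∀ ξ < α, A ξ ⊆ B ξ) ∧
    ∀ β < α, Order.IsSuccLimit β → A β ⊆ ⋃ ξ < β, B ξ

/-- Strongly Baire spaces. The ordinals of the universe of `X` are enough: by passing to a
continuous cofinal subnet, only regular cardinals `α` with `α ≤ #X` impose a condition. -/
def StronglyBaire (X : Type u) [TopologicalSpace X] : Prop :=
  ∀ (α : Ordinal.{u}) (A B : Ordinal.{u} → Set X),
    (∀ ξ < α, IsClosed (A ξ)) → MonotoneOn A (Iio α) →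
    (∀ ξ < α, IsClosed (B ξ)) → MonotoneOn B (Iio α) →
    Occupies α B A →
    interior (⋃ ξ < α, A ξ) ⊆ closure (⋃ ξ < α, interior (B ξ))

/-- The countable chain condition: every disjoint system of open sets is at most countable. -/
def CountableChainCondition (X : Type u) [TopologicalSpace X] : Prop :=
  ∀ 𝒰 : Set (Set X), (∀ U ∈ 𝒰, IsOpen U) → 𝒰.PairwiseDisjoint id → 𝒰.Countable

/-- `κ` is a caliber of `X`: every family of `κ` nonempty open sets (repetitions allowed) has a
subfamily of `κ` members with a common point. -/
def IsCaliber (X : Type u) [TopologicalSpace X] (κ : Cardinal.{u}) : Prop :=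
  ∀ (I : Type u) (U : I → Set X), #I = κ → (∀ i, IsOpen (U i)) → (∀ i, (U i).Nonempty) →
    ∃ J : Set I, #J = κ ∧ (⋂ i ∈ J, U i).Nonempty

/-- `C_p(X)`: the continuous real functions on `X` with the topology of pointwise convergence,
that is, the subspace topology inherited from the product `X → ℝ`. -/
abbrev Cp (X : Type u) [TopologicalSpace X] : Type u := {f : X → ℝ // Continuous f}

/-!
For a compact set `Y` of continuous functions, a set `D` of points and `ε`, let `controlled Y D ε`
be the set of points `x` such that any two members of `Y` that agree on `D` differ by at most `ε`
at `x`. This set is closed and grows with `D`. By compactness of `Y`, if `D` is a directed union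
of sets `D i`, then `controlled Y D ε` is covered by the sets `controlled Y (D i) ε'` for any
`ε' > ε` (`controlled_iUnion_subset`). So along a well-ordering of `D` the net
`controlled Y (D ξ) ε'` occupies the net `controlled Y (D ξ) ε`, and in a strongly Baire space a
nonempty open subset of `controlled Y D ε` contains a nonempty open set controlled by a proper
initial segment of `D`, at the price of a slightly larger `ε`. Enumerating `D` in the order type of
its cardinality, this lowers the cardinality of `D`, and by well-founded induction `D` becomes
countable (`exists_countable_controlled`). Starting from `D = univ`, `ε = 0`, every nonempty open
set contains a nonempty open set that is `ε`-controlled by a countable set. By the countable chain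
condition, countably many such open sets have a dense union, so for every `ε` a single countable
set controls a dense set, hence the whole space. Letting `ε → 0`, a countable set of points
separates the members of `Y`, and `Y` embeds into a countable power of `ℝ`.

In a Baire space with all regular uncountable cardinals as calibers, `ℵ₁` gives the countable chain
condition. For the strong Baire property, nets of countable cofinality are covered by the
Baire property. If a net has uncountable cofinality `κ` and no `B ξ` has interior in an open set
`W ⊆ ⋃ A ξ`, then the sets `W \ B ξ` along a cofinal set of order type `κ` are open and nonempty,
so `κ` of them have a common point, which lies in `W` and in no `B ξ` at all; a contradiction.
-/

/-! ### Points controlled by a set of points -/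

/-- The points `x` at which any two members of `Y` that agree on `D` differ by at most `ε`. -/
def controlled {X : Type u} [TopologicalSpace X] (Y : Set (Cp X)) (D : Set X) (ε : ℝ) : Set X :=
  {x | ∀ f ∈ Y, ∀ g ∈ Y, EqOn f.1 g.1 D → |f.1 x - g.1 x| ≤ ε}

section Controlled

variable {X : Type u} [TopologicalSpace X] {Y : Set (Cp X)}

theorem isClosed_controlled (Y : Set (Cp X)) (D : Set X) (ε : ℝ) :
    IsClosed (controlled Y D ε) := by
  have h : controlled Y D ε =
      ⋂ f ∈ Y, ⋂ g ∈ Y, ⋂ _ : EqOn f.1 g.1 D, {x | |f.1 x - g.1 x| ≤ ε} := by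
    ext x
    simp [controlled]
  rw [h]
  refine isClosed_biInter fun f _ => isClosed_biInter fun g _ => isClosed_iInter fun _ => ?_
  exact isClosed_le (f.2.sub g.2).abs continuous_const

theorem controlled_mono {D D' : Set X} (hD : D ⊆ D') {ε ε' : ℝ} (hε : ε ≤ ε') :
    controlled Y D ε ⊆ controlled Y D' ε' :=
  fun _ hx f hf g hg h => (hx f hf g hg (h.mono hD)).trans hε

theorem continuous_Cp_eval (x : X) : Continuous fun f : Cp X => f.1 x :=
  (continuous_apply x).comp continuous_subtype_val

theorem controlled_iUnion_subset (hY : IsCompact Y) {ι : Type*} [Nonempty ι] {D : ι → Set X}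
    (hD : Directed (· ⊆ ·) D) {ε ε' : ℝ} (hε : ε < ε') :
    controlled Y (⋃ i, D i) ε ⊆ ⋃ i, controlled Y (D i) ε' := by
  intro x hx
  by_contra hcon
  -- The pairs witnessing that `x` is not controlled by `D i`, with a non-strict bound so that
  -- they form a compact set.
  let K : ι → Set (Cp X × Cp X) := fun i =>
    (Y ×ˢ Y) ∩ ({p | EqOn p.1.1 p.2.1 (D i)} ∩ {p | ε' ≤ |p.1.1 x - p.2.1 x|})
  have hcl : ∀ i, IsClosed ({p : Cp X × Cp X | EqOn p.1.1 p.2.1 (D i)} ∩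
      {p | ε' ≤ |p.1.1 x - p.2.1 x|}) := by
    intro i
    have ev₁ : ∀ z, Continuous fun p : Cp X × Cp X => p.1.1 z :=
      fun z => (continuous_Cp_eval z).comp continuous_fst
    have ev₂ : ∀ z, Continuous fun p : Cp X × Cp X => p.2.1 z :=
      fun z => (continuous_Cp_eval z).comp continuous_snd
    refine IsClosed.inter ?_ (isClosed_le continuous_const ((ev₁ x).sub (ev₂ x)).abs)
    have : {p : Cp X × Cp X | EqOn p.1.1 p.2.1 (D i)} = ⋂ z ∈ D i, {p | p.1.1 z = p.2.1 z} := by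
      ext p
      simp [EqOn]
    rw [this]
    exact isClosed_biInter fun z _ => isClosed_eq (ev₁ z) (ev₂ z)
  have hK : ∀ i, IsCompact (K i) := fun i => (hY.prod hY).inter_right (hcl i)
  obtain ⟨p, hp⟩ := IsCompact.nonempty_iInter_of_directed_nonempty_isCompact_isClosed K
    (fun i j => by
      obtain ⟨k, hik, hjk⟩ := hD i j
      exact ⟨k, fun q hq => ⟨hq.1, hq.2.1.mono hik, hq.2.2⟩,
        fun q hq => ⟨hq.1, hq.2.1.mono hjk, hq.2.2⟩⟩)
    (fun i => by
      have hi : x ∉ controlled Y (D i) ε' := fun h => hcon (mem_iUnion.2 ⟨i, h⟩)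
      simp only [controlled, mem_ofPred_eq, not_forall, not_le] at hi
      obtain ⟨f, hf, g, hg, hfg, h⟩ := hi
      exact ⟨(f, g), ⟨hf, hg⟩, hfg, h.le⟩)
    hK (fun i => (hK i).isClosed)
  rw [mem_iInter] at hp
  have i₀ : ι := Classical.arbitrary ι
  have h := hx p.1 (hp i₀).1.1 p.2 (hp i₀).1.2 fun z hz => by
    obtain ⟨i, hi⟩ := mem_iUnion.1 hz
    exact (hp i).2.1 hi
  exact absurd ((hp i₀).2.2.trans h) hε.not_ge

/-! ### Reduction to countable controlling sets -/

/-- One step of the descent: in a strongly Baire space, the controlling set can be replaced by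
one of smaller cardinality, on a smaller open set and with a slightly larger `ε`. -/
theorem exists_controlled_card_lt (hX : StronglyBaire X) (hY : IsCompact Y) {D : Set X}
    (hD : ℵ₀ ≤ #D) {ε ε' : ℝ} (hε : ε < ε') {U : Set X} (hUo : IsOpen U) (hU : U.Nonempty)
    (hUD : U ⊆ controlled Y D ε) :
    ∃ V ⊆ U, IsOpen V ∧ V.Nonempty ∧ ∃ E : Set X, #E < #D ∧ V ⊆ controlled Y E ε' := by
  obtain ⟨a, hεa, haε'⟩ := exists_between hε
  obtain ⟨r, _, hr⟩ := Cardinal.exists_ord_eq D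
  let S : Ordinal.{u} → Set X := fun ξ => (↑) '' {d : D | Ordinal.typein r d < ξ}
  have hSmono : Monotone S := fun ξ η h =>
    image_mono (ofPred_subset_ofPred.2 fun _ hd => hd.trans_le h)
  have hlim : ∀ β, Order.IsSuccLimit β → S β ⊆ ⋃ ξ : Iio β, S ξ := by
    rintro β hβ _ ⟨d, hd, rfl⟩
    have hdβ := hβ.succ_lt (mem_ofPred.1 hd)
    exact mem_iUnion.2 ⟨⟨_, mem_Iio.2 hdβ⟩, d, mem_ofPred.2 (Order.lt_succ _), rfl⟩
  have hcover : ∀ β, Order.IsSuccLimit β → ∀ b c : ℝ, b < c →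
      controlled Y (S β) b ⊆ ⋃ ξ < β, controlled Y (S ξ) c := by
    intro β hβ b c hbc x hx
    have : Nonempty (Iio β) := ⟨⟨0, hβ.bot_lt⟩⟩
    have hdir : Directed (· ⊆ ·) fun ξ : Iio β => S ξ :=
      Monotone.directed_le fun ξ η h => hSmono h
    have := controlled_iUnion_subset hY hdir hbc (controlled_mono (hlim β hβ) le_rfl hx)
    obtain ⟨ξ, hξ⟩ := mem_iUnion.1 this
    exact mem_iUnion₂.2 ⟨ξ, ξ.2, hξ⟩
  have hα : Order.IsSuccLimit (#D).ord := Cardinal.isSuccLimit_ord hD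
  have hSα : D ⊆ S (#D).ord := fun x hx => ⟨⟨x, hx⟩, by
    rw [mem_ofPred_eq, hr]
    exact Ordinal.typein_lt_type r _, rfl⟩
  have key := hX (#D).ord (fun ξ => controlled Y (S ξ) a) (fun ξ => controlled Y (S ξ) ε')
    (fun ξ _ => isClosed_controlled _ _ _)
    (fun ξ _ η _ h => controlled_mono (hSmono h) le_rfl)
    (fun ξ _ => isClosed_controlled _ _ _)
    (fun ξ _ η _ h => controlled_mono (hSmono h) le_rfl)
    ⟨fun ξ _ => controlled_mono subset_rfl haε'.le, fun β _ hβ => hcover β hβ _ _ haε'⟩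
  have hUint : U ⊆ interior (⋃ ξ < (#D).ord, controlled Y (S ξ) a) :=
    interior_maximal ((hUD.trans (controlled_mono hSα le_rfl)).trans (hcover _ hα _ _ hεa)) hUo
  obtain ⟨x, hx⟩ := hU
  obtain ⟨y, hyU, hy⟩ := mem_closure_iff.1 (key (hUint hx)) U hUo hx
  obtain ⟨ξ, hξ, hyξ⟩ := mem_iUnion₂.1 hy
  refine ⟨U ∩ interior (controlled Y (S ξ) ε'), inter_subset_left, hUo.inter isOpen_interior,
    ⟨y, hyU, hyξ⟩, S ξ, ?_, inter_subset_right.trans interior_subset⟩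
  refine Cardinal.mk_image_le.trans_lt ?_
  obtain ⟨d, rfl⟩ := (Ordinal.typein_surj r (hr ▸ hξ) : ∃ d, Ordinal.typein r d = ξ)
  simp only [Ordinal.typein_lt_typein]
  exact Ordinal.card_typein (r := r) d ▸ Cardinal.card_typein_lt d hr

theorem exists_countable_controlled (hX : StronglyBaire X) (hY : IsCompact Y) (D : Set X)
    {ε ε' : ℝ} (hε : ε < ε') {U : Set X} (hUo : IsOpen U) (hU : U.Nonempty)
    (hUD : U ⊆ controlled Y D ε) :
    ∃ V ⊆ U, IsOpen V ∧ V.Nonempty ∧ ∃ E : Set X, E.Countable ∧ V ⊆ controlled Y E ε' := by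
  induction hκ : #D using WellFoundedLT.induction generalizing D ε U with
  | ind κ ih =>
    subst hκ
    rcases le_or_gt (#D) ℵ₀ with hD | hD
    · exact ⟨U, subset_rfl, hUo, hU, D, Cardinal.le_aleph0_iff_set_countable.1 hD,
        hUD.trans (controlled_mono subset_rfl hε.le)⟩
    · obtain ⟨a, hεa, haε'⟩ := exists_between hε
      obtain ⟨V, hVU, hVo, hV, E, hE, hVE⟩ :=
        exists_controlled_card_lt hX hY hD.le hεa hUo hU hUD
      obtain ⟨W, hWV, hW⟩ := ih _ hE E haε' hVo hV hVE rfl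
      exact ⟨W, hWV.trans hVU, hW⟩

/-! ### The countable chain condition and metrizability -/

/-- Under the countable chain condition, if the open sets with property `P` form a `π`-base, then
countably many of them have a dense union. -/
theorem CountableChainCondition.exists_countable_dense_sUnion (hX : CountableChainCondition X)
    {P : Set X → Prop}
    (hP : ∀ U : Set X, IsOpen U → U.Nonempty → ∃ V ⊆ U, IsOpen V ∧ V.Nonempty ∧ P V) :
    ∃ 𝒱 : Set (Set X), 𝒱.Countable ∧ (∀ V ∈ 𝒱, P V) ∧ Dense (⋃₀ 𝒱) := by
  obtain ⟨𝒱, h𝒱⟩ := zorn_subset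
    {𝒱 : Set (Set X) | (∀ V ∈ 𝒱, IsOpen V ∧ P V) ∧ 𝒱.PairwiseDisjoint id} (by
      intro c hc hchain
      refine ⟨⋃₀ c, ⟨?_, ?_⟩, fun s hs => subset_sUnion_of_mem hs⟩
      · rintro V ⟨s, hs, hV⟩
        exact (hc hs).1 V hV
      · exact (pairwiseDisjoint_sUnion hchain.directedOn).2 fun s hs => (hc hs).2)
  refine ⟨𝒱, hX 𝒱 (fun V hV => (h𝒱.prop.1 V hV).1) h𝒱.prop.2, fun V hV => (h𝒱.prop.1 V hV).2, ?_⟩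
  rw [dense_iff_inter_open]
  intro U hUo hU
  by_contra hcon
  obtain ⟨V, hVU, hVo, hV, hPV⟩ := hP U hUo hU
  have hdisj : ∀ W ∈ 𝒱, Disjoint V W := fun W hW =>
    disjoint_left.2 fun x hxV hxW => hcon ⟨x, hVU hxV, W, hW, hxW⟩
  have hmem : V ∈ 𝒱 := by
    refine h𝒱.le_of_ge (y := insert V 𝒱) ⟨?_, ?_⟩ (subset_insert _ _) (mem_insert _ _)
    · exact forall_mem_insert.2 ⟨⟨hVo, hPV⟩, h𝒱.prop.1⟩
    · exact h𝒱.prop.2.insert fun W hW _ => hdisj W hW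
  exact hV.ne_empty (disjoint_self.1 (hdisj V hmem))

theorem exists_countable_controlled_eq_univ (hX : StronglyBaire X)
    (hccc : CountableChainCondition X) (hY : IsCompact Y) {ε : ℝ} (hε : 0 < ε) :
    ∃ C : Set X, C.Countable ∧ controlled Y C ε = univ := by
  obtain ⟨𝒱, hc, h𝒱, hd⟩ := hccc.exists_countable_dense_sUnion
    (P := fun V => ∃ E : Set X, E.Countable ∧ V ⊆ controlled Y E ε) fun U hUo hU =>
      exists_countable_controlled hX hY univ hε hUo hU fun x _ f _ g _ h => by
        simp [h (mem_univ x)]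
  choose! E hEc hE using h𝒱
  refine ⟨⋃ V ∈ 𝒱, E V, hc.biUnion hEc, eq_univ_of_univ_subset ?_⟩
  rw [← hd.closure_eq]
  exact closure_minimal (sUnion_subset fun V hV =>
    (hE V hV).trans (controlled_mono (subset_biUnion_of_mem hV) le_rfl)) (isClosed_controlled _ _ _)

theorem StronglyBaire.metrizableSpace_of_isCompact (hX : StronglyBaire X)
    (hccc : CountableChainCondition X) (hY : IsCompact Y) :
    TopologicalSpace.MetrizableSpace Y := by
  choose C hCc hC using fun n : ℕ =>
    exists_countable_controlled_eq_univ hX hccc hY (Nat.one_div_pos_of_nat (α := ℝ) (n := n))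
  let T : Set X := ⋃ n, C n
  have : Countable T := (countable_iUnion hCc).to_subtype
  have : CompactSpace Y := isCompact_iff_compactSpace.1 hY
  let Φ : Y → T → ℝ := fun f t => f.1.1 t
  have hΦ : Continuous Φ :=
    continuous_pi fun t => (continuous_Cp_eval (t : X)).comp continuous_subtype_val
  have hinj : Function.Injective Φ := by
    intro f g hfg
    refine Subtype.ext (Subtype.ext (funext fun x => ?_))
    have hle : ∀ n : ℕ, |f.1.1 x - g.1.1 x| ≤ 1 / ((n : ℝ) + 1) := fun n =>
      (hC n ▸ mem_univ x : x ∈ controlled Y (C n) _) _ f.2 _ g.2 fun t ht =>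
        congrFun hfg ⟨t, mem_iUnion.2 ⟨n, ht⟩⟩
    have h0 : |f.1.1 x - g.1.1 x| ≤ 0 :=
      ge_of_tendsto' tendsto_one_div_add_atTop_nhds_zero_nat hle
    exact sub_eq_zero.1 (abs_nonpos_iff.1 h0)
  exact (hΦ.isClosedEmbedding hinj).isEmbedding.metrizableSpace

end Controlled

/-! ### Calibers -/

theorem CountableChainCondition.of_isCaliber_aleph_one {X : Type u} [TopologicalSpace X]
    (h : IsCaliber X ℵ₁) : CountableChainCondition X := by
  intro 𝒰 hopen hdisj
  by_contra hcount
  -- The empty set may belong to `𝒰`, and has to be discarded.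
  have hcount' : ¬ (𝒰 \ {∅}).Countable := fun hc => hcount <|
    (hc.insert ∅).mono fun U hU => by
      by_cases hU0 : U = ∅
      · exact Or.inl hU0
      · exact Or.inr ⟨hU, hU0⟩
  have hcard : ℵ₁ ≤ #(𝒰 \ {∅} : Set (Set X)) := by
    rw [← Cardinal.succ_aleph0, Order.succ_le_iff, ← not_le]
    rwa [Cardinal.le_aleph0_iff_set_countable]
  obtain ⟨𝒲, h𝒲, hcard𝒲⟩ := Cardinal.le_mk_iff_exists_subset.1 hcard
  obtain ⟨J, hJ, x, hx⟩ := h 𝒲 (fun U => U) hcard𝒲 (fun U => hopen _ (h𝒲 U.2).1)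
    (fun U => nonempty_iff_ne_empty.2 (h𝒲 U.2).2)
  have hsub : J.Subsingleton := by
    intro U hU V hV
    by_contra hne
    exact disjoint_left.1 (hdisj (h𝒲 U.2).1 (h𝒲 V.2).1 fun e => hne (Subtype.ext e))
      (mem_iInter₂.1 hx U hU) (mem_iInter₂.1 hx V hV)
  have h1 : (ℵ₁ : Cardinal.{u}) ≤ ℵ₀ := hJ ▸ Cardinal.le_aleph0_iff_set_countable.2 hsub.countable
  exact absurd h1 Cardinal.aleph0_lt_aleph_one.not_ge

/-- In a Baire space, the interior of a countable union of closed sets is contained in the closure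
of the union of their interiors. -/
theorem interior_iUnion_subset_closure_iUnion_interior {X : Type*} [TopologicalSpace X]
    [BaireSpace X] {ι : Type*} [Countable ι] {A : ι → Set X} (hA : ∀ i, IsClosed (A i)) :
    interior (⋃ i, A i) ⊆ closure (⋃ i, interior (A i)) := by
  intro x hx
  rw [mem_closure_iff]
  intro O hO hxO
  obtain ⟨i₀, -⟩ := mem_iUnion.1 (interior_subset hx)
  have hd : Dense (⋃ i, interior ((interior (⋃ i, A i))ᶜ ∪ A i)) := by
    refine dense_iUnion_interior_of_closed
      (fun i => isOpen_interior.isClosed_compl.union (hA i)) (eq_univ_of_forall fun y => ?_)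
    by_cases hy : y ∈ interior (⋃ i, A i)
    · obtain ⟨i, hi⟩ := mem_iUnion.1 (interior_subset hy)
      exact mem_iUnion.2 ⟨i, Or.inr hi⟩
    · exact mem_iUnion.2 ⟨i₀, Or.inl hy⟩
  obtain ⟨y, ⟨hyO, hyW⟩, hy⟩ :=
    hd.inter_open_nonempty _ (hO.inter isOpen_interior) ⟨x, hxO, hx⟩
  obtain ⟨i, hi⟩ := mem_iUnion.1 hy
  refine ⟨y, hyO, mem_iUnion.2 ⟨i, ?_⟩⟩
  refine interior_maximal (t := interior ((interior (⋃ i, A i))ᶜ ∪ A i) ∩ interior (⋃ i, A i))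
    (fun z hz => (interior_subset hz.1).resolve_left fun h => h hz.2)
    (isOpen_interior.inter isOpen_interior) ⟨hi, hyW⟩

/-- A subset of full cardinality in a well-order whose order type is the initial ordinal of its
cardinality is cofinal. -/
theorem isCofinal_of_mk_eq {S : Type u} [LinearOrder S] [WellFoundedLT S]
    (hS : (#S).ord = Ordinal.type (α := S) (· < ·)) {J : Set S} (hJ : #J = #S) : IsCofinal J := by
  intro s
  by_contra! hcon
  exact ((Cardinal.mk_le_mk_of_subset fun j hj => hcon j hj).trans_lt
    (Cardinal.mk_Iio_lt s hS)).ne hJ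

theorem StronglyBaire.of_isCaliber {X : Type u} [TopologicalSpace X] [BaireSpace X]
    (h : ∀ κ : Cardinal.{u}, κ.IsRegular → ℵ₀ < κ → IsCaliber X κ) : StronglyBaire X := by
  intro α A B hAc hAm hBc hBm hocc
  obtain ⟨s, hs, htype⟩ := Ordinal.exists_ord_cof_eq α.ToType
  have hcard : #s = α.cof := by
    have := congrArg Ordinal.card htype
    rwa [Ordinal.card_type, Cardinal.card_ord, Ordinal.cof_toType] at this
  let o : s → Ordinal.{u} := fun i => (Ordinal.ToType.mk.symm i.1).1
  have ho : ∀ i, o i < α := fun i => (Ordinal.ToType.mk.symm i.1).2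
  have hcof : ∀ ξ < α, ∃ i : s, ξ ≤ o i := by
    intro ξ hξ
    obtain ⟨t, hts, ht⟩ := hs (Ordinal.ToType.mk ⟨ξ, hξ⟩)
    exact ⟨⟨t, hts⟩, (Ordinal.ToType.mk.le_symm_apply (x := ⟨ξ, hξ⟩)).2 ht⟩
  have homono : Monotone o := fun i j hij => Ordinal.ToType.mk.symm.monotone hij
  rcases le_or_gt α.cof ℵ₀ with hle | hlt
  · have : Countable s := by rwa [← Cardinal.mk_le_aleph0_iff, hcard]
    have hsub : (⋃ ξ < α, A ξ) ⊆ ⋃ i, A (o i) := iUnion₂_subset fun ξ hξ => by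
      obtain ⟨i, hi⟩ := hcof ξ hξ
      exact (hAm hξ (ho i) hi).trans (subset_iUnion (fun i => A (o i)) i)
    refine (interior_mono hsub).trans ((interior_iUnion_subset_closure_iUnion_interior
      fun i => hAc _ (ho i)).trans (closure_mono (iUnion_subset fun i => ?_)))
    exact (interior_mono (hocc.1 _ (ho i))).trans
      (subset_biUnion_of_mem (u := fun ξ => interior (B ξ)) (ho i))
  · have hreg : α.cof.IsRegular :=
      Cardinal.isRegular_cof (Ordinal.one_lt_cof_iff.1 (Cardinal.one_lt_aleph0.trans hlt))
    intro x hx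
    rw [mem_closure_iff]
    intro O hO hxO
    by_contra hcon
    have hWo : IsOpen (O ∩ interior (⋃ ξ < α, A ξ)) := hO.inter isOpen_interior
    obtain ⟨J, hJ, y, hy⟩ := h _ hreg hlt s
      (fun i => (O ∩ interior (⋃ ξ < α, A ξ)) \ B (o i)) hcard
      (fun i => hWo.sdiff (hBc _ (ho i))) fun i => by
        rw [sdiff_nonempty]
        intro hsub
        exact hcon ⟨x, hxO, mem_biUnion (ho i) (interior_maximal hsub hWo ⟨hxO, hx⟩)⟩
    have hJcof : IsCofinal J :=
      isCofinal_of_mk_eq (by rw [hcard, htype, Ordinal.cof_toType]) (hJ.trans hcard.symm)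
    have hynot : ∀ ξ < α, y ∉ B ξ := by
      intro ξ hξ hyB
      obtain ⟨i, hi⟩ := hcof ξ hξ
      obtain ⟨j, hj, hij⟩ := hJcof i
      exact (mem_iInter₂.1 hy j hj).2 (hBm hξ (ho j) (hi.trans (homono hij)) hyB)
    have hJne : J.Nonempty := by
      rw [← nonempty_coe_sort, ← Cardinal.mk_ne_zero_iff, hJ]
      exact (Cardinal.aleph0_pos.trans hlt).ne'
    obtain ⟨j, hj⟩ := hJne
    obtain ⟨ξ, hξ, hyA⟩ := mem_iUnion₂.1 (interior_subset (mem_iInter₂.1 hy j hj).1.2)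
    exact hynot ξ hξ (hocc.1 ξ hξ hyA)

theorem theorem4p1 (X : Type u) [TopologicalSpace X] :
    (StronglyBaire X → CountableChainCondition X →
      ∀ Y : Set (Cp X), IsCompact Y → TopologicalSpace.MetrizableSpace Y) ∧
    (BaireSpace X → (∀ κ : Cardinal.{u}, κ.IsRegular → ℵ₀ < κ → IsCaliber X κ) →
      StronglyBaire X ∧ CountableChainCondition X ∧
        ∀ Y : Set (Cp X), IsCompact Y → TopologicalSpace.MetrizableSpace Y) := by
  refine ⟨fun hX hccc Y hY => hX.metrizableSpace_of_isCompact hccc hY, fun _ hcal => ?_⟩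
  have hX : StronglyBaire X := .of_isCaliber hcal
  have hccc : CountableChainCondition X := .of_isCaliber_aleph_one
    (hcal _ Cardinal.isRegular_aleph_one Cardinal.aleph0_lt_aleph_one)
  exact ⟨hX, hccc, fun Y hY => hX.metrizableSpace_of_isCompact hccc hY⟩
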